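/- Let $X$ be an elliptic curve over $\mathbb{Q}$. For a prime $p$ let $A(p)=|X(\mathbb{F}_p)|$ be the number of $\mathbb{F}_p$-points (including the point at infinity) of the reduction modulo $p$ of a Weierstrass equation of $X$ that is minimal at $p$, and put $$b_X(p)=\sqrt{p}\left(\frac{A(p)}{p}-1\right).$$ Call $p$ good if $X$ has good reduction at $p$. Then all sufficiently large primes $p$ are good and satisfy $-2<b_X(p)<3$. Moreover, the inequalities $-2<b_X(p)<3$ hold for every good prime $p$. -/

import Mathlib

namespace WeierstrassCurve

/-- A minimal Weierstrass equation at the prime `p` of a Weierstrass curve `X` over `ℚ`: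
a minimal equation over `ℤ_[p]` of the base change of `X` to `ℚ_[p]`. -/
noncomputable def minimalAt (X : WeierstrassCurve ℚ) (p : ℕ) [Fact p.Prime] :
    WeierstrassCurve ℚ_[p] :=
  (X.baseChange ℚ_[p]).minimal ℤ_[p]

instance (X : WeierstrassCurve ℚ) (p : ℕ) [Fact p.Prime] : IsMinimal ℤ_[p] (X.minimalAt p) :=
  inferInstanceAs (IsMinimal ℤ_[p] ((X.baseChange ℚ_[p]).minimal ℤ_[p]))

/-- The prime `p` is good for `X`: a minimal equation of `X` at `p` has good reduction. -/
def IsGoodPrime (X : WeierstrassCurve ℚ) (p : ℕ) [Fact p.Prime] : Prop :=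
  (X.minimalAt p).HasGoodReduction ℤ_[p]

/-- The reduction of `X` modulo `p`, a Weierstrass curve over `𝔽_p`. The residue field of `ℤ_[p]`
is identified with `ZMod p`. -/
noncomputable def reductionMod (X : WeierstrassCurve ℚ) (p : ℕ) [Fact p.Prime] :
    WeierstrassCurve (ZMod p) :=
  ((X.minimalAt p).reduction ℤ_[p]).map (PadicInt.residueField (p := p)).toRingHom

/-- `A(p) = |X(𝔽_p)|`: the number of points, including the point at infinity, of the projective
plane cubic over `𝔽_p` that is the reduction of `X` modulo `p`. -/
noncomputable def pointCount (X : WeierstrassCurve ℚ) (p : ℕ) [Fact p.Prime] : ℕ :=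
  Nat.card {P : ZMod p × ZMod p // (X.reductionMod p).toAffine.Equation P.1 P.2} + 1

/-- `b_X(p) = √p (A(p) / p - 1)`. -/
noncomputable def bFun (X : WeierstrassCurve ℚ) (p : ℕ) [Fact p.Prime] : ℝ :=
  √(p : ℝ) * ((X.pointCount p : ℝ) / (p : ℝ) - 1)

end WeierstrassCurve

/-!
The reduction of `X` at a good prime `p` is an elliptic curve over `𝔽_p`, so the inequalities
follow from Hasse's bound `(p - N)² ≤ 4p`, where `N` is the number of affine points:
`b_X(p) = (N + 1 - p) / √p` lies between `-2 + 1 / √p` and `2 + 1 / √p`. For `p = 2` the trivial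
estimate `0 ≤ N ≤ 4` is enough. All large primes are good, because they divide no denominator of a
coefficient and neither the numerator nor the denominator of the discriminant: the given equation is
then integral with unit discriminant, hence a minimal equation has unit discriminant too.

Hasse's bound is proved by Manin's elementary method, over any finite field `F` of odd cardinality
`q`. Let `f = 4x³ + b₂x² + 2b₄x + b₆` (`Ψ₂Sq`), so that the curve `W` is `y² = f(x)` after
completing the square. On its quadratic twist `f(t) y² = f(x)` over `F(t)` there are the points
`Q = (t, 1)` and `P = (t^q, f(t)^((q-1)/2))`, which correspond to the identity and the Frobenius of
`W`. Let `d n` be the degree of the numerator of the `x`-coordinate of `P + nQ`.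

* The symmetric functions of `x(P + Q)` and `x(P - Q)` are quadratic forms in those of `x(P)` and
  `x(Q)` (`exists_eval_addSubMap_sym2x`). The forms have no common zero modulo any maximal ideal of
  `F[t]`, so no cancellation takes place (`exists_unit_symmTriple_eq`), and comparing degrees gives
  `d (n + 1) + d (n - 1) = 2 d n + 2` (`IsReducedX.parallelogram`).
* `d 0 = q`, and `d (-1) = N + 1`: in `x(P - Q)` the factor `t - a` of the denominator
  `(t^q - t)²` cancels to the order `1 - χ(f(a))`, with `χ` the quadratic character of `F`
  (`exists_frobSubNum_eq`), while there are `1 + χ(f(a))` points above `a` (`card_equation`).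

Hence `0 ≤ d n = n² + (q - N) n + q` for all integers `n`. This bounds the discriminant
`(q - N)² - 4q` by `0`, as the value `1` is excluded by parity (`hasse_bound`).
-/

open Polynomial

/-! ### The sum and the difference of two points -/

namespace WeierstrassCurve.Affine.Point

variable {F : Type*} [Field F] [DecidableEq F] {W : Affine F}

/-- The map `addSubMap` sends `(x(P)x(Q) : x(P) + x(Q) : 1)` to
`(x(P + Q)x(P - Q) : x(P + Q) + x(P - Q) : 1)`. -/
theorem exists_eval_addSubMap_sym2x (P Q : W.Point) :
    ∃ c : F, ∀ i, (W.addSubMap i).eval (P.sym2x Q) = c * (P + Q).sym2x (P - Q) i := by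
  rcases P with _ | ⟨x₁, y₁, h₁⟩
  · refine ⟨1, fun i => ?_⟩
    rw [← zero_def, zero_add, zero_sub, sym2x_neg_right]
    rcases Q with _ | ⟨x₂, y₂, h₂⟩
    · fin_cases i <;> simp [addSubMap, sym2x, ← zero_def]
    · fin_cases i <;> simp [addSubMap, sym2x, two_mul, sq]
  rcases Q with _ | ⟨x₂, y₂, h₂⟩
  · refine ⟨1, fun i => ?_⟩
    rw [← zero_def, add_zero, sub_zero]
    fin_cases i <;> simp [addSubMap, sym2x, two_mul, sq]
  have e₁ := (equation_iff _ _).mp h₁.1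
  have e₂ := (equation_iff _ _).mp h₂.1
  by_cases hx : x₁ = x₂
  · -- If `x₁ = x₂`, then `Q = P` or `Q = -P`, and the doubling formula decides.
    have key : ∀ (x y : F) (h : W.Nonsingular x y),
        ∃ c : F, ∀ i, (W.addSubMap i).eval ![x * x, x + x, 1] =
          c * (some x y h + some x y h).sym2x 0 i := by
      intro x y h
      have e := (equation_iff _ _).mp h.1
      by_cases hy : y = W.negY x y
      · refine ⟨x ^ 4 - W.b₄ * x ^ 2 - 2 * W.b₆ * x - W.b₈, fun i => ?_⟩
        rw [add_self_of_Y_eq hy]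
        rw [negY] at hy
        have h2 : 2 * y + W.a₁ * x + W.a₃ = 0 := by linear_combination hy
        have h3 : 4 * x ^ 3 + W.b₂ * x ^ 2 + 2 * W.b₄ * x + W.b₆ = 0 := by
          simp only [b₂, b₄, b₆]
          linear_combination (2 * y + W.a₁ * x + W.a₃) * h2 - 4 * e
        fin_cases i <;> simp [addSubMap, sym2x]
        · ring
        · linear_combination h3
        · ring
      · refine ⟨(2 * y + W.a₁ * x + W.a₃) ^ 2, fun i => ?_⟩
        rw [add_self_of_Y_ne hy]
        have hs := slope_of_Y_ne (W := W) rfl hy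
        rw [negY] at hy hs
        have h2 : 2 * y + W.a₁ * x + W.a₃ ≠ 0 := fun h0 => hy (by linear_combination h0)
        have hs' : W.slope x x y y * (2 * y + W.a₁ * x + W.a₃) =
            3 * x ^ 2 + 2 * W.a₂ * x + W.a₄ - W.a₁ * y := by
          rw [hs]
          rw [show y - (-y - W.a₁ * x - W.a₃) = 2 * y + W.a₁ * x + W.a₃ by ring,
            div_mul_cancel₀ _ h2]
        fin_cases i <;> simp [addSubMap, sym2x, addX]
        · simp only [b₄, b₆, b₈]
          linear_combination
            -(W.slope x x y y * (2 * y + W.a₁ * x + W.a₃)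
              + (3 * x ^ 2 + 2 * W.a₂ * x + W.a₄ - W.a₁ * y)
              + W.a₁ * (2 * y + W.a₁ * x + W.a₃)) * hs' + (W.a₁ ^ 2 + 4 * W.a₂ + 8 * x) * e
        · simp only [b₂, b₄, b₆]
          linear_combination -4 * e
        · ring
    subst hx
    by_cases hy : y₁ = W.negY x₁ y₂
    · have : some x₁ y₁ h₁ = - some x₁ y₂ h₂ := by simp [neg_some, hy]
      obtain ⟨c, hc⟩ := key x₁ y₁ h₁
      refine ⟨c, fun i => ?_⟩
      have h4 : some x₁ y₂ h₂ = - some x₁ y₁ h₁ := by rw [this, neg_neg]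
      rw [h4, sub_neg_eq_add, add_neg_cancel, sym2x_neg_right, sym2x_comm 0, ← hc i]
      simp
    · have := Y_eq_of_Y_ne h₁.1 h₂.1 rfl hy
      subst this
      obtain ⟨c, hc⟩ := key x₁ y₁ h₁
      refine ⟨c, fun i => ?_⟩
      rw [sub_self, ← hc i]
      simp
  · refine ⟨(x₁ - x₂) ^ 2, fun i => ?_⟩
    have hx' := sub_ne_zero.mpr hx
    rw [sub_eq_add_neg (some x₁ y₁ h₁), neg_some, add_of_X_ne hx, add_of_X_ne hx]
    have s1 := slope_of_X_ne (W := W) (y₁ := y₁) (y₂ := y₂) hx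
    have s2 := slope_of_X_ne (W := W) (y₁ := y₁) (y₂ := W.negY x₂ y₂) hx
    rw [eq_div_iff hx'] at s1 s2
    simp only [sym2x, xRep_some, addX]
    generalize W.slope x₁ x₂ y₁ y₂ = l at s1
    generalize W.slope x₁ x₂ y₁ (W.negY x₂ y₂) = m at s2
    rw [negY] at s2
    fin_cases i <;> simp [addSubMap]
    · -- `(x₁ - x₂)² x(P ± Q)` is linear in `y₂`, and `Q ↦ -Q` exchanges the two values, so their
      -- product needs only the equations of the two points.
      have hp : (x₁ - x₂) ^ 2 * (l ^ 2 + W.a₁ * l - W.a₂ - x₁ - x₂) =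
          (x₁ ^ 3 + W.a₂ * x₁ ^ 2 + W.a₄ * x₁ + W.a₆ + (x₂ ^ 3 + W.a₂ * x₂ ^ 2 + W.a₄ * x₂ + W.a₆)
            - (x₁ - x₂) ^ 2 * (W.a₂ + x₁ + x₂) - (W.a₁ * x₂ + W.a₃) * y₁)
            - (2 * y₁ + W.a₁ * x₁ + W.a₃) * y₂ := by
        linear_combination (l * (x₁ - x₂) + (y₁ - y₂) + W.a₁ * (x₁ - x₂)) * s1 + e₁ + e₂
      have hm : (x₁ - x₂) ^ 2 * (m ^ 2 + W.a₁ * m - W.a₂ - x₁ - x₂) =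
          (x₁ ^ 3 + W.a₂ * x₁ ^ 2 + W.a₄ * x₁ + W.a₆ + (x₂ ^ 3 + W.a₂ * x₂ ^ 2 + W.a₄ * x₂ + W.a₆)
            - (x₁ - x₂) ^ 2 * (W.a₂ + x₁ + x₂) - (W.a₁ * x₂ + W.a₃) * y₁)
            + (2 * y₁ + W.a₁ * x₁ + W.a₃) * (y₂ + W.a₁ * x₂ + W.a₃) := by
        linear_combination (m * (x₁ - x₂) + (y₁ - (-y₂ - W.a₁ * x₂ - W.a₃)) + W.a₁ * (x₁ - x₂)) * s2
          + e₁ + e₂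
      refine mul_left_cancel₀ (pow_ne_zero 2 hx') ?_
      trans ((x₁ - x₂) ^ 2 * (l ^ 2 + W.a₁ * l - W.a₂ - x₁ - x₂)) *
        ((x₁ - x₂) ^ 2 * (m ^ 2 + W.a₁ * m - W.a₂ - x₁ - x₂))
      · rw [hp, hm]
        simp only [b₄, b₆, b₈]
        linear_combination (2 * y₁ + W.a₁ * x₁ + W.a₃) ^ 2 * e₂ +
          ((W.a₁ * x₂ + W.a₃) ^ 2 + 4 * (x₂ ^ 3 + W.a₂ * x₂ ^ 2 + W.a₄ * x₂ + W.a₆)) * e₁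
      · ring
    · simp only [b₂, b₄, b₆]
      linear_combination
        -(l * (x₁ - x₂) + (y₁ - y₂) + W.a₁ * (x₁ - x₂)) * s1
        - (m * (x₁ - x₂) + (y₁ - (-y₂ - W.a₁ * x₂ - W.a₃)) + W.a₁ * (x₁ - x₂)) * s2
        - 2 * e₁ - 2 * e₂
    · ring

end WeierstrassCurve.Affine.Point

/-- The coordinates of the image in `Sym² ℙ¹ = ℙ²` of the pair of points `(a : b)`, `(c : d)`. -/
def symmTriple {R : Type*} [CommRing R] (a b c d : R) : Fin 3 → R :=
  ![a * c, a * d + b * c, b * d]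

/-! ### Unimodular triples -/

section Unimodular

variable {R : Type*} [CommRing R]

/-- Two unimodular triples that represent the same point of the projective plane over the fraction
field differ by a unit. -/
theorem exists_unit_mul_of_proportional {u g : Fin 3 → R} (hu : Ideal.span (Set.range u) = ⊤)
    (hg : Ideal.span (Set.range g) = ⊤) (h : ∀ i j, u i * g j = u j * g i) :
    ∃ c : Rˣ, ∀ i, u i = c * g i := by
  obtain ⟨a, ha⟩ := Ideal.mem_span_range_iff_exists_fun.mp
    (show (1 : R) ∈ Ideal.span (Set.range g) from hg ▸ Submodule.mem_top)
  obtain ⟨b, hb⟩ := Ideal.mem_span_range_iff_exists_fun.mp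
    (show (1 : R) ∈ Ideal.span (Set.range u) from hu ▸ Submodule.mem_top)
  have key : ∀ j, u j = (∑ i, a i * u i) * g j := fun j => by
    rw [Finset.sum_mul]
    calc u j = u j * ∑ i, a i * g i := by rw [ha, mul_one]
      _ = _ := by
        rw [Finset.mul_sum]
        exact Finset.sum_congr rfl fun i _ => by linear_combination - a i * h i j
  have hc : IsUnit (∑ i, a i * u i) := by
    refine IsUnit.of_mul_eq_one (∑ j, b j * g j) ?_
    rw [← hb, Finset.mul_sum]
    exact Finset.sum_congr rfl fun j _ => by rw [mul_left_comm, ← key]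
  exact ⟨hc.unit, key⟩

theorem span_symmTriple {a b c d : R} (h : IsCoprime a b) (h' : IsCoprime c d) :
    Ideal.span (Set.range (symmTriple a b c d)) = ⊤ := by
  by_contra hne
  obtain ⟨M, hM, hle⟩ := Ideal.exists_le_maximal _ hne
  have hp := hM.isPrime
  have mem : ∀ i, symmTriple a b c d i ∈ M := fun i => hle (Ideal.subset_span ⟨i, rfl⟩)
  have m0 : a * c ∈ M := mem 0
  have m1 : a * d + b * c ∈ M := mem 1
  have m2 : b * d ∈ M := mem 2
  have not_both : ∀ {x y : R}, IsCoprime x y → x ∈ M → y ∉ M := by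
    rintro x y ⟨s, t, hst⟩ hx hy
    exact hM.ne_top ((Ideal.eq_top_iff_one M).mpr
      (hst ▸ M.add_mem (M.mul_mem_left s hx) (M.mul_mem_left t hy)))
  rcases hp.mem_or_mem m0 with ha | hc
  · have hb := not_both h ha
    have hc := (hp.mem_or_mem ((M.add_mem_iff_right (M.mul_mem_right d ha)).mp m1)).resolve_left hb
    exact not_both h' hc ((hp.mem_or_mem m2).resolve_left hb)
  · have hd := not_both h' hc
    have ha := (hp.mem_or_mem ((M.add_mem_iff_left (M.mul_mem_left b hc)).mp m1)).resolve_right hd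
    exact not_both h ha ((hp.mem_or_mem m2).resolve_right hd)

/-- On an elliptic curve, `addSubMap` is a morphism: the fourth powers of the coordinates lie in the
ideal generated by its values. -/
theorem WeierstrassCurve.span_eval_addSubMap (W : WeierstrassCurve R) [W.IsElliptic]
    {x : Fin 3 → R} (hx : Ideal.span (Set.range x) = ⊤) :
    Ideal.span (Set.range fun i => (W.addSubMap i).eval x) = ⊤ := by
  by_contra hne
  obtain ⟨M, hM, hle⟩ := Ideal.exists_le_maximal _ hne
  refine hM.ne_top (top_le_iff.mp (hx ▸ Ideal.span_le.mpr ?_))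
  rintro _ ⟨i, rfl⟩
  refine hM.isPrime.mem_of_pow_mem 4 ?_
  rw [← W.addSubMapCoeff_condition x i]
  exact M.sum_mem fun j _ => M.mul_mem_left _ (hle (Ideal.subset_span ⟨j, rfl⟩))

end Unimodular

/-! ### Degrees -/

section Degree

variable {F : Type*} [Field F]

/-- The product and the sum of the fractions `a / b` and `a' / b'` have the numerators `a * a'` and
`a * b' + b * a'` over `b * b'`. These bounds on the degrees force `a / b` to have positive
degree. -/
theorem degree_lt_of_natDegree_symm {a b a' b' : F[X]} {d : ℕ}
    (h₀ : (a * a').natDegree = 2 * d + 2) (h₁ : (a * b' + b * a').natDegree ≤ 2 * d + 1)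
    (h₂ : (b * b').natDegree ≤ 2 * d) : b.degree < a.degree := by
  have h0 : a * a' ≠ 0 := fun h => by simp [h] at h₀
  have ha := left_ne_zero_of_mul h0
  have ha' := right_ne_zero_of_mul h0
  by_contra! hlt
  have hb : b ≠ 0 := by rintro rfl; simp [ha] at hlt
  have hle := natDegree_le_natDegree hlt
  rw [natDegree_mul ha ha'] at h₀
  have hba := natDegree_mul hb ha'
  -- The summand `b * a'` has too large a degree for the sum, so the other one has the same degree.
  have key : (a * b').natDegree = (b * a').natDegree := by
    rw [← natDegree_sub_eq_right_of_natDegree_lt (p := a * b' + b * a') (q := b * a') (by omega)]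
    congr 1; ring
  have hb' : b' ≠ 0 := by rintro rfl; simp at key; omega
  rw [natDegree_mul ha hb'] at key
  rw [natDegree_mul hb hb'] at h₂
  omega

variable (W : WeierstrassCurve F)

theorem natDegree_eval_addSubMap {A B : F[X]} (h : B.degree < A.degree) :
    (((W.map C).addSubMap 0).eval (symmTriple A B X 1)).natDegree = 2 * A.natDegree + 2 ∧
    (((W.map C).addSubMap 1).eval (symmTriple A B X 1)).natDegree ≤ 2 * A.natDegree + 1 ∧
    (((W.map C).addSubMap 2).eval (symmTriple A B X 1)).natDegree ≤ 2 * A.natDegree := by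
  have hA : A ≠ 0 := by rintro rfl; simp at h
  have hB : B.natDegree ≤ A.natDegree := natDegree_le_natDegree h.le
  have hBX : (B * X).natDegree ≤ A.natDegree := by
    by_cases hB0 : B = 0
    · simp [hB0]
    · rw [natDegree_mul_X hB0]
      exact natDegree_lt_natDegree hB0 h
  have hAX : (A * X).natDegree = A.natDegree + 1 := natDegree_mul_X hA
  have hT : (A + B * X).natDegree ≤ A.natDegree := natDegree_add_le_of_degree_le le_rfl hBX
  simp [WeierstrassCurve.addSubMap, symmTriple]
  generalize hd : A.natDegree = d at *
  generalize hs : A * X = s at *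
  generalize ht : A + B * X = t at *
  have m2 : ∀ {p q : F[X]} {m n k : ℕ}, p.natDegree ≤ m → q.natDegree ≤ n → m + n ≤ k →
    (p * q).natDegree ≤ k := fun hp hq hk => (natDegree_mul_le_of_le hp hq).trans hk
  have hc : ∀ c : F, (C c).natDegree ≤ 0 := fun c => (natDegree_C c).le
  have hcs : ∀ c : F, ∀ {p q : F[X]} {m n k : ℕ}, p.natDegree ≤ m → q.natDegree ≤ n → m + n ≤ k →
    (C c * p * q).natDegree ≤ k := fun c {p q m n k} hp hq hk =>
      m2 (m2 (hc c) hp (Nat.zero_add _).le) hq hk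
  refine ⟨?_, ?_, ?_⟩
  · have hs2 : (s ^ 2).natDegree = 2 * d + 2 := by rw [natDegree_pow, hAX]; ring
    rw [sub_sub, sub_sub, natDegree_sub_eq_left_of_natDegree_lt, hs2]
    rw [hs2, Nat.lt_succ_iff]
    refine natDegree_add_le_of_degree_le (hcs _ hAX.le hB (by omega))
      (natDegree_add_le_of_degree_le (hcs _ hT hB (by omega))
        (m2 (hc _) (n := 2 * d) ?_ (by omega)))
    exact (natDegree_pow_le_of_le 2 hB)
  · rw [← C_ofNat 2]
    refine natDegree_add_le_of_degree_le (natDegree_add_le_of_degree_le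
      (natDegree_add_le_of_degree_le (hcs _ hT hAX.le (by omega)) (hcs _ hAX.le hB (by omega)))
      (hcs _ hT hB (by omega))) (m2 (hc _) (n := 2 * d) ?_ (by omega))
    exact natDegree_pow_le_of_le 2 hB
  · rw [← C_ofNat 4, ← hs, show t ^ 2 - C 4 * (A * X) * B = (A - B * X) ^ 2 by
      rw [← ht, C_ofNat]; ring]
    exact natDegree_pow_le_of_le 2 ((natDegree_sub_le_of_le hd.le hBX).trans_eq (max_self d))

end Degree

/-! ### Degrees of `x`-coordinates on a twist -/

namespace WeierstrassCurve

/-- `V` has the `b`-invariants of the quadratic twist `α y² = 4x³ + b₂x² + 2b₄x + b₆` of `W`, with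
`x(P) / α` on `V` in the place of `x`. Only the `b`-invariants matter for `x`-coordinates. -/
structure IsTwistBy {F K : Type*} [CommRing F] [CommRing K] (W : WeierstrassCurve F)
    (φ : F →+* K) (α : K) (V : WeierstrassCurve K) : Prop where
  b₂ : V.b₂ = α * φ W.b₂
  b₄ : V.b₄ = α ^ 2 * φ W.b₄
  b₆ : V.b₆ = α ^ 3 * φ W.b₆
  b₈ : V.b₈ = α ^ 4 * φ W.b₈

namespace Affine

section

variable {F K : Type*} [Field F] [Field K] [Algebra F[X] K] {V : Affine K} {α : K}

/-- `A / B` is a reduced fraction that represents `x(P) / α`. At the point at infinity this means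
that `B = 0` and `A` is a unit. -/
def IsReducedX (α : K) (P : V.Point) (A B : F[X]) : Prop :=
  IsCoprime A B ∧ P.xRep 0 * algebraMap F[X] K B = α * algebraMap F[X] K A * P.xRep 1

theorem exists_isReducedX [IsFractionRing F[X] K] (hα : α ≠ 0) (P : V.Point) :
    ∃ A B : F[X], IsReducedX α P A B := by
  rcases P with _ | ⟨x, y, h⟩
  · exact ⟨1, 0, isCoprime_one_left, by simp [← Point.zero_def]⟩
  · obtain ⟨a, b, hab, h⟩ := IsFractionRing.exists_reduced_fraction F[X] (x / α)
    refine ⟨a, b, hab.isCoprime, ?_⟩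
    have hb : algebraMap F[X] K b ≠ 0 := IsFractionRing.to_map_ne_zero_of_mem_nonZeroDivisors b.2
    rw [IsFractionRing.mk'_eq_div, div_eq_div_iff hb hα] at h
    simp [← h, mul_comm]

variable [FaithfulSMul F[X] K]

theorem IsReducedX.exists_xRep_eq (hα : α ≠ 0) {P : V.Point} {A B : F[X]}
    (h : IsReducedX α P A B) : ∃ l : K, l ≠ 0 ∧
      P.xRep 0 = l * (α * algebraMap F[X] K A) ∧ P.xRep 1 = l * algebraMap F[X] K B := by
  have hA : B = 0 → algebraMap F[X] K A ≠ 0 := by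
    rintro rfl
    have := (isCoprime_zero_right.mp h.1).ne_zero
    simpa using this
  obtain ⟨-, h⟩ := h
  rcases P with _ | ⟨x, y, hxy⟩
  · rw [← Point.zero_def] at h ⊢
    have hB : B = 0 := by simpa using h
    refine ⟨(α * algebraMap F[X] K A)⁻¹, inv_ne_zero (mul_ne_zero hα (hA hB)), ?_, ?_⟩
    · simp only [Point.xRep_zero, Matrix.cons_val_zero]
      exact (inv_mul_cancel₀ (mul_ne_zero hα (hA hB))).symm
    · simp [hB]
  · have hB : B ≠ 0 := by
      intro hB
      simp [hB, hα] at h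
      exact hA hB (by simpa using h)
    have hB' : algebraMap F[X] K B ≠ 0 := by simpa using hB
    refine ⟨(algebraMap F[X] K B)⁻¹, inv_ne_zero hB', ?_, ?_⟩
    · simp at h ⊢
      field_simp
      exact h
    · simp [hB']

theorem IsReducedX.degree_eq (hα : α ≠ 0) {P : V.Point} {A B A' B' : F[X]}
    (h : IsReducedX α P A B) (h' : IsReducedX α P A' B') :
    A.degree = A'.degree ∧ B.degree = B'.degree := by
  obtain ⟨l, hl, h0, h1⟩ := h.exists_xRep_eq hα
  obtain ⟨m, hm, h0', h1'⟩ := h'.exists_xRep_eq hα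
  have e : A * B' = A' * B := by
    apply FaithfulSMul.algebraMap_injective F[X] K
    rw [h0] at h0'
    rw [h1] at h1'
    simp only [map_mul]
    refine mul_left_cancel₀ (mul_ne_zero (mul_ne_zero hl hm) hα) ?_
    linear_combination m * algebraMap F[X] K B' * h0' - m * α * algebraMap F[X] K A' * h1'
  have d1 : A ∣ A' := h.1.dvd_of_dvd_mul_right ⟨B', e.symm⟩
  have d2 : A' ∣ A := h'.1.dvd_of_dvd_mul_right ⟨B, e⟩
  have d3 : B ∣ B' := h.1.symm.dvd_of_dvd_mul_left ⟨A', by rw [e, mul_comm]⟩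
  have d4 : B' ∣ B := h'.1.symm.dvd_of_dvd_mul_left ⟨A, by rw [← e, mul_comm]⟩
  exact ⟨degree_eq_degree_of_associated (associated_of_dvd_dvd d1 d2),
    degree_eq_degree_of_associated (associated_of_dvd_dvd d3 d4)⟩

variable [DecidableEq K] {W : Affine F} [W.IsElliptic]

/-- The formulas for `x(P ± Q)` involve no cancellation, since both sides are unimodular. -/
theorem exists_unit_symmTriple_eq (hα : α ≠ 0)
    (hV : IsTwistBy W ((algebraMap F[X] K).comp C) α V) {P Q : V.Point}
    {A B A' B' S T S' T' : F[X]} (hP : IsReducedX α P A B) (hQ : IsReducedX α Q A' B')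
    (hS : IsReducedX α (P + Q) S T) (hS' : IsReducedX α (P - Q) S' T') :
    ∃ c : F[X]ˣ, ∀ i, symmTriple S T S' T' i =
      c * ((W.map C).addSubMap i).eval (symmTriple A B A' B') := by
  refine exists_unit_mul_of_proportional (span_symmTriple hS.1 hS'.1)
    ((W.map C).span_eval_addSubMap (span_symmTriple hP.1 hQ.1)) ?_
  obtain ⟨c, hc⟩ := Point.exists_eval_addSubMap_sym2x P Q
  obtain ⟨l, hl, l0, l1⟩ := hP.exists_xRep_eq hα
  obtain ⟨m, hm, m0, m1⟩ := hQ.exists_xRep_eq hα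
  obtain ⟨r, hr, r0, r1⟩ := hS.exists_xRep_eq hα
  obtain ⟨s, hs, s0, s1⟩ := hS'.exists_xRep_eq hα
  have key : ∀ i, (l * m * α) ^ 2 *
      algebraMap F[X] K (((W.map C).addSubMap i).eval (symmTriple A B A' B')) =
      c * r * s * algebraMap F[X] K (symmTriple S T S' T' i) := by
    intro i
    have hi := hc i
    simp only [Point.sym2x, l0, l1, m0, m1, r0, r1, s0, s1] at hi
    fin_cases i <;> simp [addSubMap, symmTriple, map_ofNat, hV.b₂, hV.b₄, hV.b₆, hV.b₈] at hi ⊢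
    · refine mul_left_cancel₀ (pow_ne_zero 2 hα) ?_
      linear_combination hi
    · refine mul_left_cancel₀ hα ?_
      linear_combination hi
    · linear_combination hi
  intro i j
  apply FaithfulSMul.algebraMap_injective F[X] K
  rw [map_mul, map_mul]
  refine mul_left_cancel₀ (pow_ne_zero 2 (mul_ne_zero (mul_ne_zero hl hm) hα)) ?_
  linear_combination algebraMap F[X] K (symmTriple S T S' T' i) * key j -
    algebraMap F[X] K (symmTriple S T S' T' j) * key i

/-- The parallelogram law for degrees of `x`-coordinates. The condition that `x(P) / α` has positive
degree, that is, that `P` specializes to the origin at `t = ∞`, propagates to `P ± Q`. -/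
theorem IsReducedX.parallelogram (hα : α ≠ 0)
    (hV : IsTwistBy W ((algebraMap F[X] K).comp C) α V) {P Q : V.Point}
    {A B S T S' T' : F[X]} (hP : IsReducedX α P A B) (hlt : B.degree < A.degree)
    (hQ : IsReducedX α Q (X : F[X]) 1) (hS : IsReducedX α (P + Q) S T)
    (hS' : IsReducedX α (P - Q) S' T') :
    T.degree < S.degree ∧ T'.degree < S'.degree ∧
      S.natDegree + S'.natDegree = 2 * A.natDegree + 2 := by
  obtain ⟨c, hc⟩ := exists_unit_symmTriple_eq hα hV hP hQ hS hS'
  obtain ⟨g₀, g₁, g₂⟩ := natDegree_eval_addSubMap W hlt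
  have hdeg : ∀ q : F[X], (c * q : F[X]).natDegree = q.natDegree := fun q =>
    natDegree_eq_of_degree_eq (degree_eq_degree_of_associated
      (associated_unit_mul_left q c c.isUnit))
  rw [← hdeg, ← hc] at g₀ g₁ g₂
  simp only [symmTriple, Matrix.cons_val] at g₀ g₁ g₂
  refine ⟨degree_lt_of_natDegree_symm g₀ g₁ g₂,
    degree_lt_of_natDegree_symm (a' := S) (b' := T) (by rwa [mul_comm])
      (by rwa [mul_comm S', mul_comm T', add_comm])
      (by rwa [mul_comm]), ?_⟩
  have h0 : S * S' ≠ 0 := fun h => by simp [h] at g₀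
  rwa [natDegree_mul (left_ne_zero_of_mul h0) (right_ne_zero_of_mul h0)] at g₀

/-- The right-hand side is the degree of the numerator of the `x`-coordinate of `P + n • Q`. -/
theorem IsReducedX.quadratic_nonneg [IsFractionRing F[X] K] (hα : α ≠ 0)
    (hV : IsTwistBy W ((algebraMap F[X] K).comp C) α V) {P Q : V.Point}
    {A B A' B' : F[X]} (hP : IsReducedX α P A B) (hlt : B.degree < A.degree)
    (hQ : IsReducedX α Q (X : F[X]) 1) (hPQ : IsReducedX α (P - Q) A' B') (n : ℤ) :
    0 ≤ n ^ 2 + (A.natDegree + 1 - A'.natDegree) * n + A.natDegree := by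
  choose N D h using fun n : ℤ => exists_isReducedX (F := F) hα (P + n • Q)
  have step : ∀ n, (D n).degree < (N n).degree → (D (n + 1)).degree < (N (n + 1)).degree ∧
      (D (n - 1)).degree < (N (n - 1)).degree ∧
      (N (n + 1)).natDegree + (N (n - 1)).natDegree = 2 * (N n).natDegree + 2 := fun n hn => by
    refine (h n).parallelogram hα hV hn hQ ?_ ?_
    · simpa [add_smul, add_assoc] using h (n + 1)
    · simpa [sub_smul, add_sub_assoc] using h (n - 1)
  have h0 : IsReducedX α P (N 0) (D 0) := by simpa using h 0
  have hm1 : IsReducedX α (P - Q) (N (-1)) (D (-1)) := by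
    simpa [sub_eq_add_neg] using h (-1)
  have e0 := natDegree_eq_of_degree_eq (h0.degree_eq hα hP).1
  have em1 := natDegree_eq_of_degree_eq (hm1.degree_eq hα hPQ).1
  have d0 : (D 0).degree < (N 0).degree := by
    rwa [(h0.degree_eq hα hP).1, (h0.degree_eq hα hP).2]
  have hd : ∀ n, (D n).degree < (N n).degree := fun n => by
    induction n using Int.induction_on with
    | zero => exact d0
    | succ n ih => exact (step _ ih).1
    | pred n ih => exact (step _ ih).2.1
  have hrec := fun n => (step n (hd n)).2.2
  -- Two consecutive values determine a sequence with constant second difference `2`.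
  have main : ∀ n : ℤ, ((N n).natDegree : ℤ) =
      n ^ 2 + (A.natDegree + 1 - A'.natDegree) * n + A.natDegree ∧
      ((N (n - 1)).natDegree : ℤ) =
      (n - 1) ^ 2 + (A.natDegree + 1 - A'.natDegree) * (n - 1) + A.natDegree := fun n => by
    induction n using Int.induction_on with
    | zero =>
      refine ⟨by simp [e0], ?_⟩
      simp [em1]
      ring
    | succ n ih =>
      have := hrec n
      rw [add_sub_cancel_right]
      refine ⟨?_, ih.1⟩
      zify at this
      linear_combination this - ih.2 + 2 * ih.1
    | pred n ih =>
      have := hrec (-n - 1)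
      rw [sub_add_cancel] at this
      refine ⟨ih.2, ?_⟩
      zify at this
      linear_combination this - ih.1 + 2 * ih.2
  rw [← (main n).1]
  positivity

end

end Affine

end WeierstrassCurve

/-! ### The difference of the Frobenius and the identity -/

namespace FiniteField

theorem card_eq_two_mul_card_div_two_add_one {F : Type*} [Field F] [Fintype F]
    (hF : ringChar F ≠ 2) : Fintype.card F = 2 * (Fintype.card F / 2) + 1 := by
  have := FiniteField.odd_card_of_char_ne_two hF
  omega

theorem X_pow_card_sub_X_sq {F : Type*} [Field F] [Fintype F] :
    ((X : F[X]) ^ Fintype.card F - X) ^ 2 = ∏ a : F, (X - C a) ^ 2 := by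
  have hq := Fintype.one_lt_card (α := F)
  have hdeg := FiniteField.X_pow_card_sub_X_natDegree_eq F hq
  have hroots := FiniteField.roots_X_pow_card_sub_X F
  rw [Finset.prod_pow]
  congr 1
  have := prod_multiset_X_sub_C_of_monic_of_roots_card_eq (p := (X : F[X]) ^ Fintype.card F - X)
    (monic_X_pow_sub (by rw [degree_X]; exact_mod_cast hq)) (by rw [hroots, hdeg]; rfl)
  rw [← this, hroots]
  rfl

end FiniteField

namespace WeierstrassCurve

/-- The polynomial `Ψ₂Sq` is separable: at a double root the doubling formula would degenerate. -/
theorem eval_derivative_Ψ₂Sq_ne_zero {F : Type*} [Field F]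
    {W : WeierstrassCurve F} [W.IsElliptic] (hF : ringChar F ≠ 2) {a : F}
    (h : W.Ψ₂Sq.eval a = 0) : W.Ψ₂Sq.derivative.eval a ≠ 0 := by
  intro h'
  have h2 := Ring.two_ne_zero hF
  refine W.addSubMap_ne_zero (x := ![a ^ 2, 2 * a, 1]) (fun h => by simpa using congrFun h 2) ?_
  simp [Ψ₂Sq] at h h'
  ext i
  fin_cases i <;> simp [addSubMap]
  · refine (mul_eq_zero.mp (?_ : (2 : F) ^ 4 * _ = 0)).resolve_left (pow_ne_zero 4 h2)
    linear_combination (12 * a ^ 2 + 2 * W.b₂ * a + 2 * W.b₄) * h' - 4 * (W.b₂ + 8 * a) * h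
      - 4 * W.b_relation
  · linear_combination h
  · ring

section FiniteField

variable {F : Type*} [Field F] [Fintype F] (W : WeierstrassCurve F)

/-- On the quadratic twist, the difference of the points with `x`-coordinates `X ^ q` and `X` has
`x`-coordinate `frobSubNum / (4 * (X ^ q - X) ^ 2)`, where `q` is the cardinality of `F`. -/
noncomputable def frobSubNum : F[X] :=
  W.Ψ₂Sq * (W.Ψ₂Sq ^ (Fintype.card F / 2) + 1) ^ 2 -
    (C W.b₂ + 4 * X ^ Fintype.card F + 4 * X) * (X ^ Fintype.card F - X) ^ 2

variable {W}

/-- The terms of degree `3 * q` and `2 * q` cancel by `f ^ q = f(X ^ q)`. -/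
theorem natDegree_frobSubNum (hF : ringChar F ≠ 2) :
    W.frobSubNum.natDegree = 2 * Fintype.card F + 1 := by
  have h4 : (4 : F) ≠ 0 := by
    rw [show (4 : F) = 2 ^ 2 by norm_num]
    exact pow_ne_zero 2 (Ring.two_ne_zero hF)
  have hq := FiniteField.card_eq_two_mul_card_div_two_add_one hF
  have hpos : 0 < Fintype.card F / 2 := Nat.div_pos Fintype.one_lt_card two_pos
  have hexp : W.Ψ₂Sq ^ Fintype.card F = C 4 * X ^ (3 * Fintype.card F) +
      C W.b₂ * X ^ (2 * Fintype.card F) + C (2 * W.b₄) * X ^ Fintype.card F + C W.b₆ := by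
    rw [← FiniteField.expand_card, Ψ₂Sq]
    simp only [map_add, map_mul, map_pow, expand_C, expand_X, ← pow_mul]
    ring
  have hdeg : W.Ψ₂Sq.natDegree ≤ 3 := by
    rw [Ψ₂Sq]
    compute_degree
  have hN : W.frobSubNum = C 4 * X ^ (2 * Fintype.card F + 1) +
      (C (2 * W.b₄) * X ^ Fintype.card F + C W.b₆ + C 2 * W.Ψ₂Sq ^ (Fintype.card F / 2 + 1) + W.Ψ₂Sq
        + C 4 * X ^ (Fintype.card F + 2) - C 4 * X ^ 3 + C (2 * W.b₂) * X ^ (Fintype.card F + 1)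
        - C W.b₂ * X ^ 2) := by
    have : W.frobSubNum = W.Ψ₂Sq ^ Fintype.card F + 2 * W.Ψ₂Sq ^ (Fintype.card F / 2 + 1) + W.Ψ₂Sq -
        (C W.b₂ + 4 * X ^ Fintype.card F + 4 * X) * (X ^ Fintype.card F - X) ^ 2 := by
      have hfq : W.Ψ₂Sq ^ Fintype.card F = W.Ψ₂Sq ^ (2 * (Fintype.card F / 2) + 1) :=
        congrArg (W.Ψ₂Sq ^ ·) hq
      rw [frobSubNum, hfq]
      ring
    rw [this, hexp]
    simp only [map_mul, C_ofNat]
    ring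
  have hX : ∀ (c : F) (n : ℕ), n ≤ 2 * Fintype.card F →
      (C c * X ^ n).natDegree ≤ 2 * Fintype.card F :=
    fun c n hn => (natDegree_C_mul_X_pow_le c n).trans hn
  have hlt : (C (2 * W.b₄) * X ^ Fintype.card F + C W.b₆
        + C 2 * W.Ψ₂Sq ^ (Fintype.card F / 2 + 1) + W.Ψ₂Sq
        + C 4 * X ^ (Fintype.card F + 2) - C 4 * X ^ 3 + C (2 * W.b₂) * X ^ (Fintype.card F + 1)
        - C W.b₂ * X ^ 2).natDegree ≤ 2 * Fintype.card F := by
    have hsub : ∀ {p q : F[X]} {n : ℕ}, p.natDegree ≤ n → q.natDegree ≤ n → (p - q).natDegree ≤ n :=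
      fun hp hq => (natDegree_sub_le_of_le hp hq).trans_eq (max_self _)
    refine hsub (natDegree_add_le_of_degree_le (hsub
      (natDegree_add_le_of_degree_le (natDegree_add_le_of_degree_le (natDegree_add_le_of_degree_le
      (natDegree_add_le_of_degree_le (hX _ _ (by omega)) ?_) ?_) ?_) (hX _ _ (by omega)))
      (hX _ _ (by omega))) (hX _ _ (by omega))) (hX _ _ (by omega))
    · simp
    · refine (natDegree_C_mul_le _ _).trans ((natDegree_pow_le_of_le _ hdeg).trans (by omega))
    · omega
  rw [hN, natDegree_add_eq_left_of_natDegree_lt, natDegree_C_mul_X_pow _ _ h4]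
  rw [natDegree_C_mul_X_pow _ _ h4]
  omega

variable [DecidableEq F]

/-- The multiplicity `1 - χ(f(a))` of `X - a` in the greatest common divisor of `frobSubNum` and
`(X ^ q - X) ^ 2`, where `f = Ψ₂Sq` and `χ` is the quadratic character. The difference is never
negative, so `toNat` loses nothing. -/
noncomputable def cancelMult (W : WeierstrassCurve F) (a : F) : ℕ :=
  (1 - quadraticChar F (W.Ψ₂Sq.eval a)).toNat

/-- The reduced form `N / D` of `frobSubNum / (X ^ q - X) ^ 2`, with the degree of its numerator. -/
theorem exists_frobSubNum_eq [W.IsElliptic] (hF : ringChar F ≠ 2) :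
    ∃ N D : F[X], IsCoprime N D ∧
      N * (X ^ Fintype.card F - X) ^ 2 = W.frobSubNum * D ∧
      (N.natDegree : ℤ) = Fintype.card F + 1 + ∑ a : F, quadraticChar F (W.Ψ₂Sq.eval a) := by
  have h2 := Ring.two_ne_zero hF
  have hpos : 0 < Fintype.card F / 2 := Nat.div_pos Fintype.one_lt_card two_pos
  set w : F[X] := X ^ Fintype.card F - X with hw
  have hwa : ∀ a, w.eval a = 0 := fun a => by simp [hw, FiniteField.pow_card]
  have hcases : ∀ a, (W.cancelMult a = 2 ∧ quadraticChar F (W.Ψ₂Sq.eval a) = -1) ∨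
      (W.cancelMult a = 1 ∧ quadraticChar F (W.Ψ₂Sq.eval a) = 0) ∨
      (W.cancelMult a = 0 ∧ quadraticChar F (W.Ψ₂Sq.eval a) = 1) := fun a => by
    rcases quadraticChar_isQuadratic F (W.Ψ₂Sq.eval a) with h | h | h <;> simp [cancelMult, h]
  have hchar := fun a => quadraticChar_eq_pow_of_char_ne_two' hF (W.Ψ₂Sq.eval a)
  have hcop : Pairwise (Function.onFun IsCoprime fun a : F => (X - C a) ^ W.cancelMult a) :=
    fun a b hab => (pairwise_coprime_X_sub_C Function.injective_id hab).pow
  obtain ⟨N, hN⟩ : (∏ a : F, (X - C a) ^ W.cancelMult a) ∣ W.frobSubNum := by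
    refine Finset.prod_dvd_of_coprime (fun a _ b _ hab => hcop hab) fun a _ => ?_
    have hdw : (X - C a) ∣ w := dvd_iff_isRoot.mpr (hwa a)
    rcases hcases a with ⟨h, h'⟩ | ⟨h, h'⟩ | ⟨h, h'⟩ <;> rw [h]
    · refine dvd_sub (Dvd.dvd.mul_left (pow_dvd_pow_of_dvd (dvd_iff_isRoot.mpr ?_) 2) _)
        (Dvd.dvd.mul_left (pow_dvd_pow_of_dvd hdw 2) _)
      have := hchar a
      simp [h'] at this
      simp [← this]
    · rw [pow_one]
      refine dvd_sub (Dvd.dvd.mul_right (dvd_iff_isRoot.mpr ?_) _)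
        (Dvd.dvd.mul_left (dvd_pow hdw two_ne_zero) _)
      exact quadraticChar_eq_zero_iff.mp h'
    · simp
  refine ⟨N, ∏ a : F, (X - C a) ^ (2 - W.cancelMult a), IsCoprime.prod_right fun a _ => ?_, ?_, ?_⟩
  · have key : W.cancelMult a ≠ 2 → IsCoprime N (X - C a) := by
      intro hne
      refine ((irreducible_X_sub_C a).coprime_iff_not_dvd.mpr fun hdvd => ?_).symm
      have hNa : N.eval a = 0 := dvd_iff_isRoot.mp hdvd
      have e1 : W.frobSubNum.eval a = 0 := by rw [hN, eval_mul, hNa, mul_zero]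
      simp only [frobSubNum, eval_sub, eval_mul, eval_pow, ← hw, hwa] at e1
      rcases hcases a with ⟨h, h'⟩ | ⟨h, h'⟩ | ⟨h, h'⟩
      · exact hne h
      · have hfa := quadraticChar_eq_zero_iff.mp h'
        -- A root of `f` that were also a root of `N` would be a double root of `frobSubNum`, whose
        -- derivative there equals that of `f`.
        have hga : (∏ a : F, (X - C a) ^ W.cancelMult a).eval a = 0 := by
          rw [eval_prod]
          exact Finset.prod_eq_zero (Finset.mem_univ a) (by simp [h])
        have e2 : W.frobSubNum.derivative.eval a = 0 := by
          rw [hN, derivative_mul]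
          simp [hNa, hga]
        rw [frobSubNum, ← hw] at e2
        simp [derivative_mul, derivative_pow, hwa, hfa, hpos.ne'] at e2
        exact eval_derivative_Ψ₂Sq_ne_zero hF hfa e2
      · have hfa : W.Ψ₂Sq.eval a ≠ 0 := fun h0 => by simp [h0] at h'
        have := hchar a
        simp [h'] at this
        simp [← this, hfa] at e1
        exact h2 (by linear_combination e1)
    rcases hcases a with ⟨h, h'⟩ | ⟨h, h'⟩ | ⟨h, h'⟩
    · simp [h, isCoprime_one_right]
    all_goals exact (key (by omega)).pow_right
  · have : ∏ a : F, (X - C a) ^ 2 = (∏ a : F, (X - C a) ^ W.cancelMult a) *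
        ∏ a : F, (X - C a) ^ (2 - W.cancelMult a) := by
      rw [← Finset.prod_mul_distrib]
      refine Finset.prod_congr rfl fun a _ => ?_
      rw [← pow_add]
      congr 1
      rcases hcases a with h | h | h <;> omega
    rw [hw, FiniteField.X_pow_card_sub_X_sq, hN, this]
    ring
  · have hd := natDegree_frobSubNum (W := W) hF
    have h0 : W.frobSubNum ≠ 0 := fun h => by simp [h] at hd
    rw [hN] at h0
    rw [hN, natDegree_mul (left_ne_zero_of_mul h0) (right_ne_zero_of_mul h0),
      natDegree_prod_of_monic _ _ fun a _ => (monic_X_sub_C a).pow _] at hd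
    simp only [natDegree_pow, natDegree_X_sub_C, mul_one] at hd
    have hs : ((∑ a, W.cancelMult a : ℕ) : ℤ) =
        Fintype.card F - ∑ a : F, quadraticChar F (W.Ψ₂Sq.eval a) := by
      push_cast
      rw [Fintype.card_eq_sum_ones, Nat.cast_sum, ← Finset.sum_sub_distrib]
      refine Finset.sum_congr rfl fun a _ => ?_
      rcases hcases a with ⟨h, h'⟩ | ⟨h, h'⟩ | ⟨h, h'⟩ <;> rw [h, h'] <;> norm_num
    zify at hd hs
    linarith

/-- Completing the square, there are `1 + χ(f(a))` affine points above `x = a`. -/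
theorem card_equation (hF : ringChar F ≠ 2) :
    (Nat.card {P : F × F // W.toAffine.Equation P.1 P.2} : ℤ) =
      Fintype.card F + ∑ a : F, quadraticChar F (W.Ψ₂Sq.eval a) := by
  classical
  have h2 := Ring.two_ne_zero hF
  have e : {P : F × F // W.toAffine.Equation P.1 P.2} ≃
      Σ x : F, {z : F // z ^ 2 = W.Ψ₂Sq.eval x} := by
    refine
      { toFun := fun P => ⟨P.1.1, 2 * P.1.2 + W.a₁ * P.1.1 + W.a₃, ?_⟩
        invFun := fun s => ⟨(s.1, (s.2.1 - W.a₁ * s.1 - W.a₃) / 2), ?_⟩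
        left_inv := ?_
        right_inv := ?_ }
    · have h := (Affine.equation_iff _ _).mp P.2
      simp [Ψ₂Sq, b₂, b₄, b₆]
      linear_combination 4 * h
    · have h := s.2.2
      simp [Ψ₂Sq, b₂, b₄, b₆] at h
      rw [Affine.equation_iff]
      field_simp
      linear_combination h
    · rintro ⟨⟨x, y⟩, h⟩
      simp only [Subtype.mk.injEq, Prod.mk.injEq, true_and]
      field_simp
      ring
    · rintro ⟨x, z, h⟩
      simp only [Sigma.mk.injEq, heq_eq_eq, Subtype.mk.injEq, true_and]
      field_simp
      ring
  rw [Nat.card_congr e, Nat.card_eq_fintype_card, Fintype.card_sigma, Nat.cast_sum,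
    Fintype.card_eq_sum_ones, Nat.cast_sum, ← Finset.sum_add_distrib]
  refine Finset.sum_congr rfl fun a _ => ?_
  have := quadraticChar_card_sqrts hF (W.Ψ₂Sq.eval a)
  rw [Nat.cast_one, add_comm, ← this]
  simp [Fintype.card_subtype]

end FiniteField

end WeierstrassCurve

/-! ### Hasse's bound -/

namespace WeierstrassCurve

section Twist

variable {F K : Type*} [CommRing F] [Field K] (W : WeierstrassCurve F) (φ : F →+* K) (f : K)

/-- The quadratic twist `f y² = 4x³ + b₂x² + 2b₄x + b₆` of `W`, made monic by the substitution of
`(4fx, 4f²y)` for `(x, y)`, which avoids denominators. -/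
def twist : WeierstrassCurve K :=
  ⟨0, φ W.b₂ * f, 0, 8 * φ W.b₄ * f ^ 2, 16 * φ W.b₆ * f ^ 3⟩

theorem isTwistBy_twist : IsTwistBy W φ (4 * f) (W.twist φ f) where
  b₂ := by simp only [twist, b₂]; ring
  b₄ := by simp only [twist, b₄]; ring
  b₆ := by simp only [twist, b₆]; ring
  b₈ := by
    have h := congrArg φ W.b_relation
    simp only [map_mul, map_sub, map_pow, map_ofNat] at h
    rw [twist, b₈]
    linear_combination -64 * f ^ 4 * h

variable {W φ f}

theorem nonsingular_twist (hf : f ≠ 0) (h2 : (2 : K) ≠ 0) {x y : K} (hy : y ≠ 0)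
    (h : f * y ^ 2 = 4 * x ^ 3 + φ W.b₂ * x ^ 2 + 2 * φ W.b₄ * x + φ W.b₆) :
    (W.twist φ f).toAffine.Nonsingular (4 * f * x) (4 * f ^ 2 * y) := by
  refine (Affine.nonsingular_iff _ _).mpr ⟨(Affine.equation_iff _ _).mpr ?_, Or.inr fun h0 => ?_⟩
  · simp only [twist]
    linear_combination 16 * f ^ 3 * h
  · simp only [twist] at h0
    have : (2 : K) ^ 3 * f ^ 2 * y = 0 := by linear_combination h0
    simp [hf, h2, hy] at this

end Twist

section FiniteField

variable {F : Type*} [Field F] [Fintype F] [DecidableEq F] (W : WeierstrassCurve F) [W.IsElliptic]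

open WeierstrassCurve.Affine in
/-- The quadratic polynomial gives the degrees of the `x`-coordinates of `P + n • Q` on the twist of
`W` by `f = Ψ₂Sq` over `F(t)`, with `P = (t ^ q, f ^ (q / 2))` and `Q = (t, 1)`. -/
theorem quadratic_nonneg_of_ringChar_ne_two (hF : ringChar F ≠ 2) (n : ℤ) :
    0 ≤ n ^ 2 + (Fintype.card F - Nat.card {P : F × F // W.toAffine.Equation P.1 P.2}) * n +
      Fintype.card F := by
  classical
  let K := FractionRing F[X]
  let φ : F →+* K := (algebraMap F[X] K).comp C
  have inj : Function.Injective (algebraMap F[X] K) := IsFractionRing.injective F[X] K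
  let f : K := algebraMap F[X] K W.Ψ₂Sq
  have h2 : (2 : K) ≠ 0 := by
    rw [← map_ofNat φ 2]
    exact (map_ne_zero φ).mpr (Ring.two_ne_zero hF)
  have h4 : (4 : K) ≠ 0 := by
    rw [show (4 : K) = 2 ^ 2 by norm_num]
    exact pow_ne_zero 2 h2
  have hΨ : W.Ψ₂Sq ≠ 0 := fun h => by
    have := eval_derivative_Ψ₂Sq_ne_zero (W := W) hF (a := 0) (by simp [h])
    simp [h] at this
  have hf : f ≠ 0 := by simpa [f] using hΨ
  have hα : 4 * f ≠ 0 := mul_ne_zero h4 hf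
  let t : K := algebraMap F[X] K X
  have hft : f = 4 * t ^ 3 + φ W.b₂ * t ^ 2 + 2 * φ W.b₄ * t + φ W.b₆ := by
    simp [f, t, φ, Ψ₂Sq, C_ofNat, map_ofNat (algebraMap F[X] K)]
  have hftq : f ^ Fintype.card F = 4 * (t ^ Fintype.card F) ^ 3 +
      φ W.b₂ * (t ^ Fintype.card F) ^ 2 + 2 * φ W.b₄ * t ^ Fintype.card F + φ W.b₆ := by
    simp only [f, ← map_pow, ← FiniteField.expand_card]
    simp [t, φ, Ψ₂Sq, C_ofNat, map_ofNat (algebraMap F[X] K), map_ofNat (expand F _)]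
  have hq := FiniteField.card_eq_two_mul_card_div_two_add_one hF
  have hq1 := Fintype.one_lt_card (α := F)
  have hP := nonsingular_twist (W := W) (φ := φ) hf h2 (x := t ^ Fintype.card F)
    (pow_ne_zero (Fintype.card F / 2) hf) (by
      rw [← hftq, ← pow_mul, ← pow_succ']
      congr 1
      omega)
  have hQ := nonsingular_twist (W := W) (φ := φ) hf h2 (x := t) one_ne_zero
    (by rw [← hft]; ring)
  have hx : t ^ Fintype.card F - t ≠ 0 := by
    rw [← map_pow, ← map_sub]
    exact (map_ne_zero_iff _ inj).mpr (FiniteField.X_pow_card_sub_X_ne_zero F hq1)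
  obtain ⟨N, D, hcop, hND, hdeg⟩ := exists_frobSubNum_eq (W := W) hF
  have key := IsReducedX.quadratic_nonneg (α := 4 * f) (W := W.toAffine) hα (isTwistBy_twist W φ f)
    (P := .some _ _ hP) (Q := .some _ _ hQ) (A := X ^ Fintype.card F) (B := 1) (A' := N)
    (B' := C 4 * D) ⟨isCoprime_one_right, by simp [t]⟩ ?_ ⟨isCoprime_one_right, by simp [t]⟩ ?_ n
  · rw [natDegree_X_pow, hdeg] at key
    rw [card_equation hF]
    linarith
  · rw [degree_one, degree_X_pow]
    exact_mod_cast Fintype.card_pos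
  · refine ⟨?_, ?_⟩
    · refine (isCoprime_mul_unit_left_right (isUnit_C.mpr ?_) N D).mpr hcop
      rw [isUnit_iff_ne_zero, ← map_ne_zero φ, map_ofNat]
      exact h4
    · have hne : 4 * f * t ^ Fintype.card F ≠ 4 * f * t := fun h =>
        hx (sub_eq_zero.mpr (mul_left_cancel₀ hα h))
      rw [sub_eq_add_neg, Point.neg_some, Point.add_of_X_ne hne, Point.xRep_some]
      have hs := slope_of_X_ne (W := (W.twist φ f).toAffine)
        (y₁ := 4 * f ^ 2 * f ^ (Fintype.card F / 2))
        (y₂ := (W.twist φ f).toAffine.negY (4 * f * t) (4 * f ^ 2 * 1)) hne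
      have hND' := congrArg (algebraMap F[X] K) hND
      simp only [frobSubNum, map_mul, map_sub, map_add, map_pow, map_one, map_ofNat] at hND'
      change _ * (t ^ Fintype.card F - t) ^ 2 = (f * (f ^ (Fintype.card F / 2) + 1) ^ 2 -
        (φ W.b₂ + 4 * t ^ Fintype.card F + 4 * t) * (t ^ Fintype.card F - t) ^ 2) * _ at hND'
      rw [eq_div_iff (sub_ne_zero.mpr hne)] at hs
      generalize (W.twist φ f).toAffine.slope _ _ _ _ = s at hs ⊢
      have hs' : s * (t ^ Fintype.card F - t) = f * (f ^ (Fintype.card F / 2) + 1) := by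
        refine mul_left_cancel₀ hα ?_
        simp only [negY, twist] at hs
        linear_combination hs
      have h4C : algebraMap F[X] K (C 4 * D) = 4 * algebraMap F[X] K D := by
        rw [map_mul, C_ofNat, map_ofNat]
      rw [h4C]
      refine mul_right_cancel₀ (pow_ne_zero 2 hx) ?_
      simp only [addX, twist, Matrix.cons_val_zero, Matrix.cons_val_one]
      linear_combination 4 * algebraMap F[X] K D *
        (s * (t ^ Fintype.card F - t) + f * (f ^ (Fintype.card F / 2) + 1)) * hs' - 4 * f * hND'

/-- **Hasse's theorem** for the number of affine points, in odd characteristic. -/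
theorem hasse_bound (hF : ringChar F ≠ 2) :
    ((Fintype.card F : ℤ) - Nat.card {P : F × F // W.toAffine.Equation P.1 P.2}) ^ 2 ≤
      4 * Fintype.card F := by
  have h := W.quadratic_nonneg_of_ringChar_ne_two hF
  have hodd := FiniteField.odd_card_of_char_ne_two hF
  generalize (Fintype.card F : ℤ) - Nat.card {P : F × F // W.toAffine.Equation P.1 P.2} = a at h
  by_contra! hlt
  -- The quadratic polynomial is evaluated at the integer next to its minimum `-a / 2`.
  obtain ⟨k, rfl | rfl⟩ := Int.even_or_odd' a
  · have := h (-k)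
    linarith
  · have := h (-k)
    -- The discriminant can only be `1`, and then `q = k * (k + 1)` would be even.
    have heq : (Fintype.card F : ℤ) = k * (k + 1) := by linarith
    have := Int.even_mul_succ_self k
    rw [← heq] at this
    have := Int.even_iff.mp this
    omega

end FiniteField

end WeierstrassCurve

/-! ### Good primes -/

namespace WeierstrassCurve

variable (X : WeierstrassCurve ℚ) (p : ℕ) [Fact p.Prime]

theorem bFun_eq : X.bFun p = ((X.pointCount p : ℝ) - p) / √(p : ℝ) := by
  have hp : (0 : ℝ) < p := by exact_mod_cast (Fact.out : p.Prime).pos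
  rw [bFun, div_sub_one hp.ne', mul_div_assoc', eq_div_iff (Real.sqrt_pos.mpr hp).ne',
    div_mul_eq_mul_div, mul_right_comm, Real.mul_self_sqrt hp.le, mul_div_cancel_left₀ _ hp.ne']

variable {X p}

theorem IsGoodPrime.isElliptic_reductionMod (h : X.IsGoodPrime p) :
    (X.reductionMod p).IsElliptic := by
  have : ((X.minimalAt p).reduction ℤ_[p]).IsElliptic :=
    (hasGoodReduction_iff_isElliptic_reduction ℤ_[p]).mp h
  rw [reductionMod]
  infer_instance

theorem bFun_bounds_two (X : WeierstrassCurve ℚ) : -2 < X.bFun 2 ∧ X.bFun 2 < 3 := by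
  have hcard :
      Nat.card {P : ZMod 2 × ZMod 2 // (X.reductionMod 2).toAffine.Equation P.1 P.2} ≤ 4 :=
    (Finite.card_subtype_le _).trans_eq (by simp)
  rw [bFun_eq, pointCount]
  generalize Nat.card {P : ZMod 2 × ZMod 2 // (X.reductionMod 2).toAffine.Equation P.1 P.2} = m
    at hcard ⊢
  have h0 : (0 : ℝ) ≤ m := m.cast_nonneg
  have h4 : (m : ℝ) ≤ 4 := by exact_mod_cast hcard
  have hs : (1 : ℝ) < √((2 : ℕ) : ℝ) := Real.lt_sqrt_of_sq_lt (by norm_num)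
  rw [lt_div_iff₀ (by positivity), div_lt_iff₀ (by positivity)]
  push_cast at *
  constructor <;> linarith

theorem IsGoodPrime.bFun_bounds (h : X.IsGoodPrime p) : -2 < X.bFun p ∧ X.bFun p < 3 := by
  by_cases h2 : p = 2
  · subst h2
    exact X.bFun_bounds_two
  have := h.isElliptic_reductionMod
  have hasse := (X.reductionMod p).hasse_bound (by rwa [ZMod.ringChar_zmod_n])
  rw [ZMod.card] at hasse
  have hp1 : (1 : ℝ) < p := by exact_mod_cast (Fact.out : p.Prime).one_lt
  have hs : (1 : ℝ) < √(p : ℝ) := Real.lt_sqrt_of_sq_lt (by linarith)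
  rw [bFun_eq, pointCount, lt_div_iff₀ (by positivity), div_lt_iff₀ (by positivity)]
  generalize Nat.card {P : ZMod p × ZMod p // (X.reductionMod p).toAffine.Equation P.1 P.2} = m at *
  have hasse' : ((p : ℝ) - m) ^ 2 ≤ (2 * √(p : ℝ)) ^ 2 := by
    rw [mul_pow, Real.sq_sqrt (by positivity)]
    norm_num
    exact_mod_cast hasse
  have habs := abs_le_of_sq_le_sq' hasse' (by positivity)
  push_cast
  constructor <;> linarith [habs.1, habs.2]

open IsDiscreteValuationRing IsDedekindDomain.HeightOneSpectrum in
/-- If the equation of `X` is `p`-integral with unit discriminant, then a minimal equation, whose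
discriminant has maximal valuation, has unit discriminant as well. -/
theorem isGoodPrime_of_norm (h₁ : ‖(X.a₁ : ℚ_[p])‖ ≤ 1) (h₂ : ‖(X.a₂ : ℚ_[p])‖ ≤ 1)
    (h₃ : ‖(X.a₃ : ℚ_[p])‖ ≤ 1) (h₄ : ‖(X.a₄ : ℚ_[p])‖ ≤ 1) (h₆ : ‖(X.a₆ : ℚ_[p])‖ ≤ 1)
    (hΔ : ‖(X.Δ : ℚ_[p])‖ = 1) : X.IsGoodPrime p := by
  set Y : WeierstrassCurve ℚ_[p] := X.baseChange ℚ_[p] with hY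
  have lift : ∀ x : ℚ_[p], ‖x‖ ≤ 1 → ∃ r : ℤ_[p], algebraMap ℤ_[p] ℚ_[p] r = x :=
    fun x hx => ⟨⟨x, hx⟩, rfl⟩
  have hint : IsIntegral ℤ_[p] Y := isIntegral_of_exists_lift ℤ_[p]
    (lift _ (by simpa [Y] using h₁)) (lift _ (by simpa [Y] using h₂))
    (lift _ (by simpa [Y] using h₃)) (lift _ (by simpa [Y] using h₄))
    (lift _ (by simpa [Y] using h₆))
  have hYΔ : Y.Δ = (X.Δ : ℚ_[p]) := by
    rw [hY, baseChange, map_Δ, eq_ratCast]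
  have hval : valuation ℚ_[p] (maximalIdeal ℤ_[p]) Y.Δ = 1 := by
    obtain ⟨r, hr⟩ := lift Y.Δ (by rw [hYΔ, hΔ])
    have hu : IsUnit r := by
      rw [PadicInt.isUnit_iff, ← hΔ, ← hYΔ, ← hr]
      rfl
    rw [← hr, valuation_eq_one_iff_notMem]
    exact fun hmem => (IsLocalRing.mem_maximalIdeal r).mp hmem hu
  obtain ⟨C, hC⟩ : ∃ C : VariableChange ℚ_[p], X.minimalAt p = C • Y := ⟨_, rfl⟩
  have hmin := (inferInstance : IsMinimal ℤ_[p] (X.minimalAt p)).val_Δ_maximal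
  have hinv : C⁻¹ • X.minimalAt p = Y := by rw [hC, inv_smul_smul]
  have hint' : IsIntegral ℤ_[p] (C⁻¹ • X.minimalAt p) := by rwa [hinv]
  have hmax : valuation_Δ_aux ℤ_[p] Y ≤ valuation_Δ_aux ℤ_[p] (X.minimalAt p) := by
    rcases le_total (valuation_Δ_aux ℤ_[p] Y) (valuation_Δ_aux ℤ_[p] (X.minimalAt p)) with h | h
    · exact h
    · simpa only [hinv, one_smul] using hmin.2 hint' (by simpa only [hinv, one_smul] using h)
  refine ⟨le_antisymm ?_ ?_⟩
  · rw [← valuation_Δ_aux_eq_of_isIntegral]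
    exact (valuation_Δ_aux ℤ_[p] (X.minimalAt p)).2
  · rw [← valuation_Δ_aux_eq_of_isIntegral]
    exact hval.ge.trans ((valuation_Δ_aux_eq_of_isIntegral ℤ_[p] Y).ge.trans hmax)

theorem eventually_norm_le_one (q : ℚ) :
    ∃ N : ℕ, ∀ (p : ℕ) [Fact p.Prime], N ≤ p → ‖(q : ℚ_[p])‖ ≤ 1 := by
  refine ⟨q.den + 1, fun p _ hp => Padic.norm_rat_le_one fun hdvd => ?_⟩
  have := Nat.le_of_dvd q.den_pos hdvd
  omega

theorem eventually_norm_eq_one {q : ℚ} (hq : q ≠ 0) :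
    ∃ N : ℕ, ∀ (p : ℕ) [Fact p.Prime], N ≤ p → ‖(q : ℚ_[p])‖ = 1 := by
  obtain ⟨N, hN⟩ := eventually_norm_le_one q
  obtain ⟨M, hM⟩ := eventually_norm_le_one q⁻¹
  refine ⟨max N M, fun p _ hp => le_antisymm (hN p (le_of_max_le_left hp)) ?_⟩
  have h := hM p (le_of_max_le_right hp)
  rw [Rat.cast_inv, norm_inv] at h
  have h0 : 0 < ‖(q : ℚ_[p])‖ := norm_pos_iff.mpr (by exact_mod_cast hq)
  exact (inv_le_one₀ h0).mp h

theorem exists_forall_isGoodPrime (X : WeierstrassCurve ℚ) [X.IsElliptic] :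
    ∃ N : ℕ, ∀ (p : ℕ) [Fact p.Prime], N ≤ p → X.IsGoodPrime p := by
  obtain ⟨N₁, h₁⟩ := eventually_norm_le_one X.a₁
  obtain ⟨N₂, h₂⟩ := eventually_norm_le_one X.a₂
  obtain ⟨N₃, h₃⟩ := eventually_norm_le_one X.a₃
  obtain ⟨N₄, h₄⟩ := eventually_norm_le_one X.a₄
  obtain ⟨N₆, h₆⟩ := eventually_norm_le_one X.a₆
  obtain ⟨N, h⟩ := eventually_norm_eq_one X.isUnit_Δ.ne_zero
  refine ⟨N₁ + N₂ + N₃ + N₄ + N₆ + N, fun p _ hp => isGoodPrime_of_norm (h₁ p ?_) (h₂ p ?_)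
    (h₃ p ?_) (h₄ p ?_) (h₆ p ?_) (h p ?_)⟩ <;> omega

end WeierstrassCurve

theorem theorem14 (X : WeierstrassCurve ℚ) [X.IsElliptic] :
    (∃ N : ℕ, ∀ (p : ℕ) [Fact p.Prime], N ≤ p →
      X.IsGoodPrime p ∧ -2 < X.bFun p ∧ X.bFun p < 3) ∧
    (∀ (p : ℕ) [Fact p.Prime], X.IsGoodPrime p → -2 < X.bFun p ∧ X.bFun p < 3) := by
  obtain ⟨N, hN⟩ := X.exists_forall_isGoodPrime
  exact ⟨⟨N, fun p _ hp => ⟨hN p hp, (hN p hp).bFun_bounds⟩⟩, fun p _ h => h.bFun_bounds⟩
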